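/- For $a,b>0$ let $E=\{x\in\mathbb R^2: x_1^2/a^2+x_2^2/b^2<1\}$, let $ds$ be the line element on $\partial E$ and $\nu_y$ the outward unit normal at $y\in\partial E$. Let $H^{1/2}(\partial E)$ be the space of complex-valued $h\in L^2(\partial E,ds)$ with $$\|h\|_{H^{1/2}}^2=\int_{\partial E}|h|^2\,ds+\int_{\partial E}\int_{\partial E}\frac{|h(x)-h(z)|^2}{|x-z|^2}\,ds(x)\,ds(z)<\infty .$$ The Neumann--Poincar\'e (NP) operator on $\partial E$ is $$\mathcal K_{\partial E}[\varphi](x)=\mathrm{p.v.}\,\frac1{2\pi}\int_{\partial E}\frac{\langle y-x,\nu_y\rangle}{|x-y|^2}\,\varphi(y)\,ds(y),\qquad x\in\partial E,$$ and $\sigma(\mathcal K_{\partial E})\subset\mathbb C$ denotes its spectrum as a bounded operator on $H^{1/2}(\partial E)$. Let $(a_j)_{j\ge1}$ and $(b_j)_{j\ge1}$ be sequences of positive numbers with $b_j<a_j$ for all $j$ and $b_j/a_j\to0$ as $j\to\infty$, and let $E_j$ be the ellipse $x_1^2/a_j^2+x_2^2/b_j^2<1$. Then each $\mathcal K_{\partial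 E_j}$ is a well-defined bounded operator on $H^{1/2}(\partial E_j)$ (the principal value exists for almost every $x\in\partial E_j$), and $$\overline{\bigcup_{j=1}^\infty\sigma(\mathcal K_{\partial E_j})}=[-1/2,1/2].$$ -/

import Mathlib

open MeasureTheory Filter Topology

noncomputable section

/-- The Euclidean plane. -/
abbrev Plane : Type := EuclideanSpace ℝ (Fin 2)

/-- The open elliptic domain `x₁² / a² + x₂² / b² < 1`. -/
def ellipse (a b : ℝ) : Set Plane := {x | x 0 ^ 2 / a ^ 2 + x 1 ^ 2 / b ^ 2 < 1}

/-- The standard parametrization `t ↦ (a cos t, b sin t)` of the boundary of the ellipse. -/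
def ellipseCurve (a b : ℝ) (t : ℝ) : Plane := !₂[a * Real.cos t, b * Real.sin t]

/-- The line element `ds` on the boundary of the ellipse, as a measure on the plane:
`∫ f ds = ∫_{(0, 2π]} f (γ t) ‖γ' t‖ dt`, where `γ` is the standard parametrization. -/
def lineElement (a b : ℝ) : Measure Plane :=
  Measure.map (ellipseCurve a b)
    ((volume.restrict (Set.Ioc 0 (2 * Real.pi))).withDensity
      fun t => ENNReal.ofReal ‖deriv (ellipseCurve a b) t‖)

instance lineElement_sFinite (a b : ℝ) : SFinite (lineElement a b) := by
  unfold lineElement; infer_instance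

/-- The outward unit normal `ν_y` at a boundary point `y` of the ellipse: the normalized gradient
of the defining function `x₁² / a² + x₂² / b²` (up to the factor `2`). -/
def outwardNormal (a b : ℝ) (y : Plane) : Plane :=
  (‖(!₂[y 0 / a ^ 2, y 1 / b ^ 2] : Plane)‖)⁻¹ • (!₂[y 0 / a ^ 2, y 1 / b ^ 2] : Plane)

/-- The kernel `(1 / 2π) ⟨y - x, ν_y⟩ / |x - y|²` of the Neumann–Poincaré operator. -/
def npKernel (a b : ℝ) (x y : Plane) : ℝ :=
  1 / (2 * Real.pi) * (inner ℝ (y - x) (outwardNormal a b y) / ‖x - y‖ ^ 2)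

/-- The Sobolev space `H^{1/2}` over a curve with line element `σ`, with complex values: the
functions `h ∈ L²(σ)` whose difference quotient `(h x - h z) / |x - z|` lies in `L²(σ × σ)`.
An element is the pair consisting of `h` and its difference quotient, and the norm inherited from
the `ℓ²`-product is
`‖h‖² = ∫ |h|² dσ + ∫∫ |h x - h z|² / |x - z|² dσ(x) dσ(z)`. -/
def sobolevHalf (σ : Measure Plane) [SFinite σ] :
    Submodule ℂ (WithLp 2 (Lp ℂ 2 σ × Lp ℂ 2 (σ.prod σ))) where
  carrier := {p | ∀ᵐ q ∂(σ.prod σ), p.snd q = (p.fst q.1 - p.fst q.2) / (‖q.1 - q.2‖ : ℂ)}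
  zero_mem' := by
    have h1 := Lp.coeFn_zero ℂ 2 σ
    have h2 := Lp.coeFn_zero ℂ 2 (σ.prod σ)
    filter_upwards [h2, Measure.quasiMeasurePreserving_fst.ae h1,
      Measure.quasiMeasurePreserving_snd.ae h1] with q e2 e3 e4
    simp only [WithLp.zero_fst, WithLp.zero_snd]
    rw [e2, e3, e4]
    simp
  add_mem' := by
    intro p r hp hr
    have h1 := Lp.coeFn_add p.fst r.fst
    have h2 := Lp.coeFn_add p.snd r.snd
    filter_upwards [hp, hr, h2, Measure.quasiMeasurePreserving_fst.ae h1,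
      Measure.quasiMeasurePreserving_snd.ae h1] with q e0 e1 e2 e3 e4
    simp only [WithLp.add_fst, WithLp.add_snd]
    rw [e2, e3, e4]
    simp only [Pi.add_apply]
    rw [e0, e1]
    ring
  smul_mem' := by
    intro c p hp
    have h1 := Lp.coeFn_smul c p.fst
    have h2 := Lp.coeFn_smul c p.snd
    filter_upwards [hp, h2, Measure.quasiMeasurePreserving_fst.ae h1,
      Measure.quasiMeasurePreserving_snd.ae h1] with q e0 e2 e3 e4
    simp only [WithLp.smul_fst, WithLp.smul_snd]
    rw [e2, e3, e4]
    simp only [Pi.smul_apply, smul_eq_mul]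
    rw [e0]
    ring

/-- The space `H^{1/2}` on the boundary of the ellipse with semi-axes `a`, `b`. -/
abbrev HHalf (a b : ℝ) : Type := sobolevHalf (lineElement a b)

/-- The function (class) on the boundary that underlies an element of `H^{1/2}`. -/
def HHalf.toLp {a b : ℝ} (φ : HHalf a b) : Lp ℂ 2 (lineElement a b) := φ.1.fst

/-- `T` is the Neumann–Poincaré operator of the ellipse, as a bounded operator on `H^{1/2}`:
for almost every boundary point `x`, the principal value integral
`lim_{ε → 0+} ∫_{|x - y| > ε} k(x, y) φ(y) ds(y)` exists and equals `(T φ)(x)`. -/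
def IsNPOperator {a b : ℝ} (T : HHalf a b →L[ℂ] HHalf a b) : Prop :=
  ∀ φ : HHalf a b, ∀ᵐ x ∂(lineElement a b),
    Tendsto
      (fun ε : ℝ => ∫ y in {y : Plane | ε < ‖x - y‖},
        (npKernel a b x y : ℂ) * φ.toLp y ∂(lineElement a b))
      (𝓝[>] 0) (𝓝 ((T φ).toLp x))

/-- The standard parametrization traces out exactly the boundary of the elliptic domain. -/
theorem range_ellipseCurve {a b : ℝ} (ha : 0 < a) (hb : 0 < b) :
    Set.range (ellipseCurve a b) = frontier (ellipse a b) := by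
  have hc : Continuous fun x : Plane => x 0 ^ 2 / a ^ 2 + x 1 ^ 2 / b ^ 2 := by fun_prop
  have ho : IsOpen (ellipse a b) := isOpen_lt hc continuous_const
  ext x
  constructor
  · rintro ⟨t, rfl⟩
    have key : ∀ s : ℝ, (s • ellipseCurve a b t) 0 ^ 2 / a ^ 2
        + (s • ellipseCurve a b t) 1 ^ 2 / b ^ 2 = s ^ 2 := by
      intro s
      simp only [ellipseCurve, PiLp.smul_apply, smul_eq_mul]
      simp
      field_simp
      rw [Real.cos_sq_add_sin_sq, mul_one]
    rw [ho.frontier_eq]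
    refine ⟨?_, ?_⟩
    · have h1 : Tendsto (fun s : ℝ => s • ellipseCurve a b t) (𝓝[<] 1)
          (𝓝 (ellipseCurve a b t)) := by
        have : Continuous fun s : ℝ => s • ellipseCurve a b t := by fun_prop
        simpa using (this.tendsto 1).mono_left nhdsWithin_le_nhds
      refine mem_closure_of_tendsto h1 ?_
      have h2 : ∀ᶠ s : ℝ in 𝓝[<] 1, s ∈ Set.Ioo (0 : ℝ) 1 := Ioo_mem_nhdsLT one_pos
      filter_upwards [h2] with s hs
      have := key s
      simp only [ellipse, Set.mem_ofPred_eq, this]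
      nlinarith [hs.1, hs.2]
    · have := key 1
      simp only [one_smul] at this
      simp [ellipse, this]
  · intro hx
    have h : x 0 ^ 2 / a ^ 2 + x 1 ^ 2 / b ^ 2 = 1 := frontier_lt_subset_eq hc continuous_const hx
    set z : ℂ := ⟨x 0 / a, x 1 / b⟩ with hz
    have hn : ‖z‖ = 1 := by
      rw [← sq_eq_sq₀ (norm_nonneg _) zero_le_one, Complex.sq_norm, Complex.normSq_apply]
      simp only [hz]
      rw [one_pow, ← h]
      ring
    refine ⟨z.arg, ?_⟩
    have h0 : z ≠ 0 := by
      intro h0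
      simp [h0] at hn
    ext i
    fin_cases i
    · have : Real.cos z.arg = x 0 / a := by rw [Complex.cos_arg h0, hn, div_one]
      simp only [ellipseCurve, this]
      simp
      field_simp
    · have : Real.sin z.arg = x 1 / b := by rw [Complex.sin_arg, hn, div_one]
      simp only [ellipseCurve, this]
      simp
      field_simp

end

/-! Parametrize the ellipse by γ(t) = (a cos t, b sin t). The factor 1 - cos(s - t) divides both ⟨y
- x, ν_y⟩ ds(y) and |x - y|², so it cancels (`norm_deriv_mul_npKernel`). What is left is a smooth
positive kernel k(s + t), and the principal value is an ordinary integral. Up to the factor 4π, k is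
the Poisson kernel of the disc at r = (a - b)/(a + b). Hence the operator sends cos(ns) to (rⁿ/2)
cos(nt) and sin(ns) to -(rⁿ/2) sin(nt) (`integral_npProfile_mul_cos`).

The H^{1/2} norm is hardly used. The kernel smooths, so the operator is S ∘ J, with J the pullback
from H^{1/2} to L²(dt) and S an integral operator from L²(dt) to H^{1/2}
(`exists_npOperator_factorization`). Away from 0, the spectrum of S ∘ J is that of J ∘ S, which acts
on L²(dt) with the real symmetric kernel k(s + t). It is self-adjoint, and by the Schur test its
norm is at most ∫ k = 1/2, so the spectrum lies in [-1/2, 1/2]. The trigonometric eigenfunctions put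
±rⁿ/2 into it for every n ≥ 1.

As b_j/a_j → 0, r_j → 1. Once r_j > 1 - ε, consecutive powers of r_j are less than ε apart, so the
eigenvalues are dense in [-1/2, 1/2]. -/

/-! ### Spectra of products and eigenvalues. -/

/-- The nonzero spectra of `S ∘ J` and `J ∘ S` agree. -/
theorem mem_spectrum_comp_of_mem_spectrum_comp {H L : Type*} [NormedAddCommGroup H]
    [NormedSpace ℂ H] [NormedAddCommGroup L] [NormedSpace ℂ L] (S : L →L[ℂ] H) (J : H →L[ℂ] L)
    {z : ℂ} (hz : z ≠ 0) (h : z ∈ spectrum ℂ (S ∘L J)) : z ∈ spectrum ℂ (J ∘L S) := by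
  rw [spectrum.mem_iff] at h ⊢
  contrapose! h
  obtain ⟨u, hu⟩ := h
  set R : L →L[ℂ] L := ↑u⁻¹ with hR
  have h1 : ∀ x, R (z • x - J (S x)) = x := by
    intro x
    have := DFunLike.congr_fun u.inv_mul x
    simpa [hu, Algebra.algebraMap_eq_smul_one] using this
  have h2 : ∀ x, z • R x - J (S (R x)) = x := by
    intro x
    have := DFunLike.congr_fun u.mul_inv x
    simpa [hu, Algebra.algebraMap_eq_smul_one] using this
  -- With R = (z - JS)⁻¹, the inverse of z - SJ is z⁻¹(1 + SRJ); this is where z ≠ 0 is needed.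
  refine isUnit_iff_exists.2 ⟨z⁻¹ • (1 + S ∘L R ∘L J), ?_, ?_⟩
  · ext x
    have h3 := congrArg S (h2 (J x))
    simp only [map_sub, map_smul] at h3
    simp only [Algebra.algebraMap_eq_smul_one, mul_apply_eq_comp,
      smul_apply, sub_apply, add_apply,
      one_apply_eq_self, ContinuousLinearMap.comp_apply, map_smul, map_add, smul_add]
    rw [h3, ← smul_add, sub_add_cancel, smul_smul, inv_mul_cancel₀ hz, one_smul]
  · ext x
    have h3 := congrArg S (h1 (J x))
    simp only [Algebra.algebraMap_eq_smul_one, mul_apply_eq_comp,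
      smul_apply, sub_apply, add_apply,
      one_apply_eq_self, ContinuousLinearMap.comp_apply, map_sub, map_smul] at h3 ⊢
    rw [smul_comm z z⁻¹, ← smul_sub, smul_add, add_sub_add_comm, h3, sub_add_cancel, smul_smul, inv_mul_cancel₀ hz, one_smul]

theorem mem_spectrum_of_apply_eq_smul {L : Type*} [NormedAddCommGroup L] [NormedSpace ℂ L]
    {T : L →L[ℂ] L} {z : ℂ} {v : L} (hv : v ≠ 0) (h : T v = z • v) : z ∈ spectrum ℂ T := by
  rw [spectrum.mem_iff]
  rintro ⟨u, hu⟩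
  refine hv ?_
  have h1 := DFunLike.congr_fun u.inv_mul v
  rw [mul_apply_eq_comp, hu] at h1
  simpa [Algebra.algebraMap_eq_smul_one, h] using h1.symm

/-! ### Integral operators on L² with bounded symmetric kernels. -/

section IntegralOperator

variable {X : Type*} [MeasurableSpace X] {μ : Measure X}

theorem MeasureTheory.Lp.integrable_of_two [IsFiniteMeasure μ] (f : Lp ℂ 2 μ) : Integrable f μ :=
  (Lp.memLp f).integrable (by norm_num)

theorem MeasureTheory.Lp.integral_norm_sq (f : Lp ℂ 2 μ) : ∫ x, ‖f x‖ ^ 2 ∂μ = ‖f‖ ^ 2 := by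
  have h := L2.inner_def (𝕜 := ℂ) f f
  simp_rw [inner_self_eq_norm_sq_to_K] at h
  have h2 : ∀ x, (((‖f x‖ : ℝ) : ℂ)) ^ 2 = ((‖f x‖ ^ 2 : ℝ) : ℂ) := by intro x; push_cast; rfl
  simp only [Complex.coe_algebraMap, h2, integral_complex_ofReal] at h
  exact_mod_cast h.symm

theorem MeasureTheory.Lp.integrable_norm_sq (f : Lp ℂ 2 μ) : Integrable (fun x => ‖f x‖ ^ 2) μ :=
  (memLp_two_iff_integrable_sq_norm (Lp.aestronglyMeasurable f)).1 (Lp.memLp f)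

variable {k : X → X → ℝ} {C m : ℝ} {T : Lp ℂ 2 μ →L[ℂ] Lp ℂ 2 μ}

theorem integrable_kernel_mul {F : X × X → ℂ} (hk : Measurable (Function.uncurry k))
    (hC : ∀ s t, |k s t| ≤ C) (hF : Integrable F (μ.prod μ)) :
    Integrable (fun q : X × X => (k q.1 q.2 : ℂ) * F q) (μ.prod μ) := by
  refine hF.bdd_mul (c := C) ?_ (ae_of_all _ fun q => ?_)
  · exact (Complex.measurable_ofReal.comp hk).aestronglyMeasurable
  · simpa using hC q.1 q.2

theorem inner_integralOperator (hT : ∀ f, T f =ᵐ[μ] fun t => ∫ s, (k t s : ℂ) * f s ∂μ)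
    (f g : Lp ℂ 2 μ) : inner ℂ g (T f)
      = ∫ t, ∫ s, (k t s : ℂ) * (starRingEnd ℂ (g t) * f s) ∂μ ∂μ := by
  rw [L2.inner_def]
  refine integral_congr_ae ?_
  filter_upwards [hT f] with t ht
  rw [RCLike.inner_apply, ht, mul_comm, ← integral_const_mul]
  exact integral_congr_ae (ae_of_all _ fun s => by ring)

variable [IsFiniteMeasure μ]

theorem isSelfAdjoint_integralOperator (hk : Measurable (Function.uncurry k))
    (hC : ∀ s t, |k s t| ≤ C) (hsymm : ∀ s t, k s t = k t s)
    (hT : ∀ f, T f =ᵐ[μ] fun t => ∫ s, (k t s : ℂ) * f s ∂μ) : IsSelfAdjoint T := by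
  rw [ContinuousLinearMap.isSelfAdjoint_iff_isSymmetric]
  intro f g
  change inner ℂ (T f) g = inner ℂ f (T g)
  rw [← inner_conj_symm, inner_integralOperator hT, inner_integralOperator hT,
    integral_integral_swap, ← integral_conj]
  · refine integral_congr_ae (ae_of_all _ fun t => ?_)
    simp only
    rw [← integral_conj]
    refine integral_congr_ae (ae_of_all _ fun s => ?_)
    simp only [map_mul, Complex.conj_conj, Complex.conj_ofReal]
    rw [hsymm s t]
    ring
  · have hg : Integrable (fun t => starRingEnd ℂ (g t)) μ :=
      (LinearIsometryEquiv.integrable_comp_iff Complex.conjLIE).2 (Lp.integrable_of_two g)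
    exact integrable_kernel_mul hk hC (hg.mul_prod (Lp.integrable_of_two f))

/-- The Schur test for a nonnegative symmetric kernel. -/
theorem norm_integralOperator_le (hk : Measurable (Function.uncurry k))
    (hC : ∀ s t, |k s t| ≤ C) (hsymm : ∀ s t, k s t = k t s) (h0 : ∀ s t, 0 ≤ k s t)
    (hm : 0 < m) (hint : ∀ t, ∫ s, k t s ∂μ = m)
    (hT : ∀ f, T f =ᵐ[μ] fun t => ∫ s, (k t s : ℂ) * f s ∂μ) : ‖T‖ ≤ m := by
  have key : ∀ f g : Lp ℂ 2 μ, ‖(inner ℂ g (T f) : ℂ)‖ ≤ m / 2 * (‖g‖ ^ 2 + ‖f‖ ^ 2) := by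
    intro f g
    have hI : ∀ F : X × X → ℝ, Integrable F (μ.prod μ) →
        Integrable (fun q : X × X => k q.1 q.2 * F q) (μ.prod μ) := by
      intro F hF
      refine hF.bdd_mul (c := C) hk.aestronglyMeasurable (ae_of_all _ fun q => ?_)
      simpa using hC q.1 q.2
    have hf2 := hI _ ((Lp.integrable_norm_sq f).comp_snd μ)
    have hg2 := hI _ ((Lp.integrable_norm_sq g).comp_fst μ)
    have hgf := integrable_kernel_mul hk hC
      (((LinearIsometryEquiv.integrable_comp_iff Complex.conjLIE).2 (Lp.integrable_of_two g)).mul_prod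
        (Lp.integrable_of_two f))
    have e1 : ∫ q : X × X, k q.1 q.2 * ‖g q.1‖ ^ 2 ∂(μ.prod μ) = m * ‖g‖ ^ 2 := by
      rw [integral_prod _ hg2, ← (Lp.integral_norm_sq g), ← integral_const_mul]
      refine integral_congr_ae (ae_of_all _ fun t => ?_)
      simp only
      rw [integral_mul_const, hint]
    have e2 : ∫ q : X × X, k q.1 q.2 * ‖f q.2‖ ^ 2 ∂(μ.prod μ) = m * ‖f‖ ^ 2 := by
      rw [integral_prod_symm _ hf2, ← (Lp.integral_norm_sq f), ← integral_const_mul]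
      refine integral_congr_ae (ae_of_all _ fun t => ?_)
      simp only
      rw [integral_mul_const]
      simp_rw [fun s => hsymm s t]
      rw [hint]
    rw [inner_integralOperator hT]
    rw [← integral_prod (fun q : X × X => (k q.1 q.2 : ℂ) * (starRingEnd ℂ (g q.1) * f q.2)) hgf]
    -- Pointwise 2|g(t)||f(s)| ≤ |g(t)|² + |f(s)|²; by symmetry of the kernel both marginal
    -- integrals equal m.
    calc _ ≤ ∫ q : X × X, 2⁻¹ * (k q.1 q.2 * ‖g q.1‖ ^ 2 + k q.1 q.2 * ‖f q.2‖ ^ 2) ∂(μ.prod μ) := by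
          refine norm_integral_le_of_norm_le ((hg2.add hf2).const_mul _)
            (ae_of_all _ fun q => ?_)
          rw [norm_mul, norm_mul, Complex.norm_real, Real.norm_of_nonneg (h0 _ _), RCLike.norm_conj]
          nlinarith [mul_nonneg (h0 q.1 q.2) (sq_nonneg (‖g q.1‖ - ‖f q.2‖))]
      _ = m / 2 * (‖g‖ ^ 2 + ‖f‖ ^ 2) := by
          rw [integral_const_mul, integral_add hg2 hf2, e1, e2]
          ring
  refine ContinuousLinearMap.opNorm_le_bound _ hm.le fun f => ?_
  -- Scaling f by m balances the two squares: m‖Tf‖² ≤ (m/2)(‖Tf‖² + m²‖f‖²), and the first term on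
  -- the right is absorbed.
  have h1 := key ((m : ℂ) • f) (T f)
  rw [map_smul, inner_smul_right, inner_self_eq_norm_sq_to_K, norm_smul, Complex.norm_mul,
    Complex.norm_real, Real.norm_of_nonneg hm.le] at h1
  have h2 : ‖T f‖ ^ 2 ≤ (m * ‖f‖) ^ 2 := by
    have h3 : ‖((‖T f‖ : ℝ) : ℂ) ^ 2‖ = ‖T f‖ ^ 2 := by simp
    have h4 : m * ‖T f‖ ^ 2 ≤ m / 2 * (‖T f‖ ^ 2 + (m * ‖f‖) ^ 2) := h3 ▸ h1
    nlinarith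
  exact le_of_sq_le_sq h2 (by positivity)

end IntegralOperator

/-! ### The kernel profile and its Poisson integral. -/

/-- The profile of the Neumann–Poincaré kernel of an ellipse, as a function of `cos (s + t)`;
the argument is clamped to `[-1, 1]`. -/
noncomputable def npProfile (a b c : ℝ) : ℝ :=
  a * b / (2 * Real.pi * ((a ^ 2 + b ^ 2) - (a ^ 2 - b ^ 2) * max (-1) (min 1 c)))

theorem npProfile_cos (a b u : ℝ) : npProfile a b (Real.cos u) =
    a * b / (2 * Real.pi * ((a ^ 2 + b ^ 2) - (a ^ 2 - b ^ 2) * Real.cos u)) := by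
  rw [npProfile, min_eq_right (Real.cos_le_one u), max_eq_right (Real.neg_one_le_cos u)]

section
variable {a b : ℝ}

theorem two_mul_sq_le_npProfile_denom (hb : 0 < b) (hab : b < a) {c : ℝ} (hc : c ≤ 1) :
    2 * b ^ 2 ≤ (a ^ 2 + b ^ 2) - (a ^ 2 - b ^ 2) * c := by
  nlinarith [mul_nonneg (show 0 ≤ a ^ 2 - b ^ 2 by nlinarith) (sub_nonneg.2 hc)]

theorem npProfile_pos (hb : 0 < b) (hab : b < a) (c : ℝ) : 0 < npProfile a b c := by
  have h := two_mul_sq_le_npProfile_denom hb hab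
    (max_le (by norm_num) (min_le_left 1 c) : max (-1) (min 1 c) ≤ 1)
  have : 0 < a := hb.trans hab
  have h2 : 0 < 2 * b ^ 2 := by positivity
  unfold npProfile
  have := h2.trans_le h
  positivity

theorem npProfile_le (hb : 0 < b) (hab : b < a) (c : ℝ) :
    npProfile a b c ≤ a * b / (2 * Real.pi * (2 * b ^ 2)) := by
  have h := two_mul_sq_le_npProfile_denom hb hab
    (max_le (by norm_num) (min_le_left 1 c) : max (-1) (min 1 c) ≤ 1)
  have : 0 < a := hb.trans hab
  unfold npProfile
  gcongr

/-- Clamping is 1-Lipschitz and keeps the denominator factor above 2b², so the estimate holds on all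
of ℝ. This global bound is what later allows the kernel to be evaluated off the boundary curve. -/
theorem exists_npProfile_lipschitz (hb : 0 < b) (hab : b < a) :
    ∃ C, 0 ≤ C ∧ ∀ c c', |npProfile a b c - npProfile a b c'| ≤ C * |c - c'| := by
  have ha : 0 < a := hb.trans hab
  have hd : 0 ≤ a ^ 2 - b ^ 2 := by nlinarith
  refine ⟨a * b / (2 * Real.pi) * (a ^ 2 - b ^ 2) / (2 * b ^ 2 * (2 * b ^ 2)), by positivity,
    fun c c' => ?_⟩
  have hcl : |max (-1) (min 1 c) - max (-1) (min 1 c')| ≤ |c - c'| :=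
    (abs_max_sub_max_le_max _ _ _ _).trans (max_le (by simp)
      ((abs_min_sub_min_le_max _ _ _ _).trans (max_le (by simp) le_rfl)))
  have h1 := two_mul_sq_le_npProfile_denom hb hab
    (max_le (by norm_num) (min_le_left 1 c) : max (-1) (min 1 c) ≤ 1)
  have h2 := two_mul_sq_le_npProfile_denom hb hab
    (max_le (by norm_num) (min_le_left 1 c') : max (-1) (min 1 c') ≤ 1)
  unfold npProfile
  set x := max (-1) (min 1 c)
  set y := max (-1) (min 1 c')
  have h0 : 0 < 2 * b ^ 2 := by positivity
  have h1' := h0.trans_le h1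
  have h2' := h0.trans_le h2
  have e : a * b / (2 * Real.pi * ((a ^ 2 + b ^ 2) - (a ^ 2 - b ^ 2) * x))
      - a * b / (2 * Real.pi * ((a ^ 2 + b ^ 2) - (a ^ 2 - b ^ 2) * y))
      = a * b / (2 * Real.pi) * (a ^ 2 - b ^ 2) / (((a ^ 2 + b ^ 2) - (a ^ 2 - b ^ 2) * x)
        * ((a ^ 2 + b ^ 2) - (a ^ 2 - b ^ 2) * y)) * (x - y) := by
    have := Real.pi_pos
    field_simp
    ring
  rw [e, abs_mul, abs_of_nonneg (by positivity)]
  gcongr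

theorem continuous_npProfile (hb : 0 < b) (hab : b < a) : Continuous (npProfile a b) := by
  unfold npProfile
  refine continuous_const.div (by fun_prop) fun c => ?_
  have h := two_mul_sq_le_npProfile_denom hb hab
    (max_le (by norm_num) (min_le_left 1 c) : max (-1) (min 1 c) ≤ 1)
  have h2 : 0 < 2 * b ^ 2 := by positivity
  have := h2.trans_le h
  positivity

theorem circleAverage_poissonKernel_pow {r : ℝ} (h0 : 0 ≤ r) (h1 : r < 1) (n : ℕ) :
    Real.circleAverage (poissonKernel 0 (r : ℂ) • fun z => z ^ n) 0 1 = (r : ℂ) ^ n := by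
  refine DiffContOnCl.circleAverage_poissonKernel_smul (f := fun z : ℂ => z ^ n) ?_ ?_
  · exact (by fun_prop : Differentiable ℂ fun z : ℂ => z ^ n).diffContOnCl
  · simp [abs_of_nonneg h0, h1]

/-- With r = (a - b)/(a + b) one has 1 - r² = 4ab/(a + b)² and |e^{iu} - r|² = 2(a² + b² - (a² - b²)
cos u)/(a + b)², so 4π times the profile is the Poisson kernel at r. It reproduces the value rⁿ of
the holomorphic function zⁿ. -/
theorem integral_npProfile_exp (hb : 0 < b) (hab : b < a) (n : ℕ) :
    ∫ u in (0 : ℝ)..2 * Real.pi, (npProfile a b (Real.cos u) : ℂ) * Complex.exp (n * u * Complex.I)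
      = (((a - b) / (a + b)) ^ n / 2 : ℝ) := by
  have ha : 0 < a := hb.trans hab
  have hr0 : 0 ≤ (a - b) / (a + b) := div_nonneg (by linarith) (by linarith)
  have hr1 : (a - b) / (a + b) < 1 := by rw [div_lt_one (by linarith)]; linarith
  have h := circleAverage_poissonKernel_pow hr0 hr1 n
  rw [Real.circleAverage_def] at h
  have e : ∀ u : ℝ, (poissonKernel 0 (((a - b) / (a + b) : ℝ) : ℂ) • fun z => z ^ n)
      (circleMap 0 1 u) = (4 * Real.pi : ℂ) *
        ((npProfile a b (Real.cos u) : ℂ) * Complex.exp (n * u * Complex.I)) := by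
    intro u
    have h1 : circleMap 0 1 u ^ n = Complex.exp (n * u * Complex.I) := by
      rw [circleMap, zero_add, Complex.ofReal_one, one_mul, ← Complex.exp_nat_mul]
      ring_nf
    have h2 : poissonKernel 0 (((a - b) / (a + b) : ℝ) : ℂ) (circleMap 0 1 u)
        = 4 * Real.pi * npProfile a b (Real.cos u) := by
      have hD := two_mul_sq_le_npProfile_denom hb hab (Real.cos_le_one u)
      have hD' := (by positivity : 0 < 2 * b ^ 2).trans_le hD
      have hden : ‖circleMap 0 1 u - (((a - b) / (a + b) : ℝ) : ℂ)‖ ^ 2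
          = 2 * ((a ^ 2 + b ^ 2) - (a ^ 2 - b ^ 2) * Real.cos u) / (a + b) ^ 2 := by
        rw [Complex.sq_norm, Complex.normSq_apply]
        simp only [circleMap, zero_add, Complex.ofReal_one, one_mul, Complex.sub_re,
          Complex.sub_im, Complex.exp_ofReal_mul_I_re, Complex.exp_ofReal_mul_I_im,
          Complex.ofReal_re, Complex.ofReal_im]
        field_simp
        nlinarith [Real.sin_sq_add_cos_sq u]
      rw [poissonKernel_def, sub_zero, sub_zero, hden, npProfile_cos, norm_circleMap_zero,
        Complex.norm_real, Real.norm_of_nonneg hr0]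
      have := Real.pi_pos
      field_simp
      ring
    rw [Pi.smul_apply', h1, h2, Complex.real_smul]
    push_cast
    ring
  simp_rw [e] at h
  rw [intervalIntegral.integral_const_mul, Complex.real_smul] at h
  have hpi : (Real.pi : ℂ) ≠ 0 := by exact_mod_cast Real.pi_ne_zero
  set A := ∫ u in (0 : ℝ)..2 * Real.pi, (npProfile a b (Real.cos u) : ℂ) *
    Complex.exp (n * u * Complex.I)
  push_cast at h ⊢
  rw [← h]
  field_simp
  ring

theorem intervalIntegrable_npProfile_exp (hb : 0 < b) (hab : b < a) (n : ℕ) :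
    IntervalIntegrable (fun u : ℝ => (npProfile a b (Real.cos u) : ℂ) *
      Complex.exp (n * u * Complex.I)) volume 0 (2 * Real.pi) := by
  have := continuous_npProfile hb hab
  exact Continuous.intervalIntegrable (by fun_prop) _ _

/-- Cosines are reflected and damped by convolution with the Poisson kernel. -/
theorem integral_npProfile_mul_cos (hb : 0 < b) (hab : b < a) (n : ℕ) (θ t : ℝ) :
    ∫ s in Set.Ioc 0 (2 * Real.pi), npProfile a b (Real.cos (s + t)) * Real.cos (n * s - θ)
      = ((a - b) / (a + b)) ^ n / 2 * Real.cos (n * t + θ) := by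
  have hc := continuous_npProfile hb hab
  -- Substituting u = s + t moves the interval of integration; periodicity moves it back.
  have hP : Function.Periodic (fun u => npProfile a b (Real.cos u) * Real.cos (n * u - (n * t + θ)))
      (2 * Real.pi) := by
    intro u
    simp only [Real.cos_add_two_pi]
    rw [show (n : ℝ) * (u + 2 * Real.pi) - (n * t + θ) = n * u - (n * t + θ) + n * (2 * Real.pi)
      by ring, Real.cos_add_nat_mul_two_pi]
  have hre : ∀ f : ℝ → ℂ, IntervalIntegrable f volume 0 (2 * Real.pi) →
      ∫ u in (0 : ℝ)..2 * Real.pi, (f u).re = (∫ u in (0 : ℝ)..2 * Real.pi, f u).re :=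
    fun f hf => Complex.reCLM.intervalIntegral_comp_comm hf
  have h2 := hre _ ((intervalIntegrable_npProfile_exp hb hab n).mul_const
    (Complex.exp (-(n * t + θ : ℝ) * Complex.I)))
  rw [intervalIntegral.integral_mul_const, integral_npProfile_exp hb hab n] at h2
  rw [← intervalIntegral.integral_of_le (by positivity)]
  calc _ = ∫ s in (0 : ℝ)..2 * Real.pi, (fun u => npProfile a b (Real.cos u) *
        Real.cos (n * u - (n * t + θ))) (s + t) := by
        refine intervalIntegral.integral_congr fun s _ => ?_
        simp only
        ring_nf
    _ = ∫ u in (0 : ℝ)..2 * Real.pi, npProfile a b (Real.cos u) *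
        Real.cos (n * u - (n * t + θ)) := by
        rw [intervalIntegral.integral_comp_add_right (fun u => npProfile a b (Real.cos u) *
          Real.cos (n * u - (n * t + θ))), zero_add, add_comm (2 * Real.pi)]
        have := hP.intervalIntegral_add_eq t 0
        rwa [zero_add] at this
    _ = _ := by
        convert h2 using 1
        · refine intervalIntegral.integral_congr fun u _ => ?_
          rw [mul_assoc, ← Complex.exp_add, Complex.re_ofReal_mul,
            show (n * u * Complex.I + -((n * t + θ : ℝ) : ℂ) * Complex.I : ℂ)
              = ((n * u - (n * t + θ) : ℝ) : ℂ) * Complex.I by push_cast; ring,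
            Complex.exp_ofReal_mul_I_re]
        · rw [Complex.re_ofReal_mul, ← Complex.ofReal_neg, Complex.exp_ofReal_mul_I_re,
            Real.cos_neg]

end

/-! ### Maps into H^{1/2} and pullbacks of L² functions. -/

theorem memLp_of_continuous_of_bound {σ : Measure Plane} [IsFiniteMeasure σ] {h : Plane → ℂ}
    {C : ℝ} (hc : Continuous h) (hC : ∀ x, ‖h x‖ ≤ C) : MemLp h 2 σ :=
  MemLp.of_bound hc.aestronglyMeasurable C (ae_of_all _ hC)

theorem norm_diffQuotient_le {h : Plane → ℂ} {C : ℝ} (h0 : 0 ≤ C)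
    (hC : ∀ x z, ‖h x - h z‖ ≤ C * ‖x - z‖) (q : Plane × Plane) :
    ‖(h q.1 - h q.2) / (‖q.1 - q.2‖ : ℂ)‖ ≤ C := by
  rw [norm_div, Complex.norm_real, norm_norm]
  exact div_le_of_le_mul₀ (norm_nonneg _) h0 (hC _ _)

theorem memLp_diffQuotient {σ : Measure Plane} [IsFiniteMeasure σ] {h : Plane → ℂ} {C : ℝ}
    (hc : Continuous h) (h0 : 0 ≤ C) (hC : ∀ x z, ‖h x - h z‖ ≤ C * ‖x - z‖) :
    MemLp (fun q : Plane × Plane => (h q.1 - h q.2) / (‖q.1 - q.2‖ : ℂ)) 2 (σ.prod σ) := by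
  refine MemLp.of_bound (Measurable.aestronglyMeasurable ?_) C
    (ae_of_all _ (norm_diffQuotient_le h0 hC))
  refine Measurable.div ?_ ?_
  · exact (by fun_prop : Continuous fun q : Plane × Plane => h q.1 - h q.2).measurable
  · exact (by fun_prop : Continuous fun q : Plane × Plane => (‖q.1 - q.2‖ : ℂ)).measurable

theorem continuous_of_norm_sub_le {h : Plane → ℂ} {C : ℝ} (h0 : 0 ≤ C)
    (hC : ∀ x z, ‖h x - h z‖ ≤ C * ‖x - z‖) : Continuous h :=
  (LipschitzWith.of_dist_le_mul (K := ⟨C, h0⟩) fun x z => by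
    simp only [dist_eq_norm]; exact hC x z).continuous

/-- The difference quotient is determined almost everywhere by the underlying function, so equality
in H^{1/2} can be checked on the L² component. -/
theorem sobolevHalf_ext {σ : Measure Plane} [SFinite σ] {p q : sobolevHalf σ}
    (h : p.1.fst = q.1.fst) : p = q := by
  refine Subtype.ext (WithLp.ofLp_injective 2 (Prod.ext h ?_))
  refine Lp.ext ?_
  filter_upwards [p.2, q.2] with x hp hq
  exact hp.trans ((by rw [h]) : _ = _) |>.trans hq.symm

/-- Integral operators with a bounded kernel that is Lipschitz in the outer variable map `L²` to
`H^{1/2}`. -/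
theorem exists_integralOperator_sobolevHalf {σ : Measure Plane} [IsFiniteMeasure σ] {X : Type*}
    [MeasurableSpace X] {μ : Measure X} [IsFiniteMeasure μ] {N : Plane → X → ℝ} {C : ℝ}
    (h0 : 0 ≤ C) (hN : ∀ x, Measurable (N x)) (hC : ∀ x s, |N x s| ≤ C)
    (hL : ∀ x z s, |N x s - N z s| ≤ C * ‖x - z‖) :
    ∃ S : Lp ℂ 2 μ →L[ℂ] sobolevHalf σ, ∀ f,
      (S f).1.fst =ᵐ[σ] fun x => ∫ s, (N x s : ℂ) * f s ∂μ := by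
  set h : Lp ℂ 2 μ → Plane → ℂ := fun f x => ∫ s, (N x s : ℂ) * f s ∂μ with hh
  have hint : ∀ (f : Lp ℂ 2 μ) x, Integrable (fun s => (N x s : ℂ) * f s) μ := fun f x =>
    (Lp.integrable_of_two f).bdd_mul (c := C)
      (Complex.measurable_ofReal.comp (hN x)).aestronglyMeasurable
      (ae_of_all _ fun s => by simpa using hC x s)
  -- Cauchy–Schwarz on a finite measure space: M is the square root of the total mass.
  obtain ⟨M, hM0, hM⟩ : ∃ M : ℝ, 0 ≤ M ∧ ∀ f : Lp ℂ 2 μ, ∫ s, ‖f s‖ ∂μ ≤ M * ‖f‖ := by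
    have h1 : ∀ f : Lp ℂ 2 μ, ∫ s, ‖f s‖ ∂μ ≤ (μ.real Set.univ) ^ (1 / 2 : ℝ) * ‖f‖ := by
      intro f
      have := eLpNorm_le_eLpNorm_mul_rpow_measure_univ (p := 1) (q := 2) (by norm_num)
        (Lp.aestronglyMeasurable f)
      rw [integral_norm_eq_lintegral_enorm (Lp.aestronglyMeasurable f), ← eLpNorm_one_eq_lintegral_enorm,
        Lp.norm_def]
      refine (ENNReal.toReal_mono ?_ this).trans_eq ?_
      · exact ENNReal.mul_ne_top (Lp.eLpNorm_ne_top f)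
          (ENNReal.rpow_ne_top_of_nonneg (by norm_num) (measure_ne_top _ _))
      · rw [ENNReal.toReal_mul, ← ENNReal.toReal_rpow, mul_comm, measureReal_def]
        norm_num
    exact ⟨_, by positivity, h1⟩
  have hB : ∀ f x, ‖h f x‖ ≤ C * M * ‖f‖ := by
    intro f x
    calc ‖h f x‖ ≤ ∫ s, C * ‖f s‖ ∂μ := by
          refine norm_integral_le_of_norm_le ((Lp.integrable_of_two f).norm.const_mul C)
            (ae_of_all _ fun s => ?_)
          rw [norm_mul, Complex.norm_real]
          exact mul_le_mul_of_nonneg_right (hC x s) (norm_nonneg _)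
      _ ≤ C * M * ‖f‖ := by
          rw [integral_const_mul, mul_assoc]
          exact mul_le_mul_of_nonneg_left (hM f) h0
  have hD : ∀ f x z, ‖h f x - h f z‖ ≤ C * M * ‖f‖ * ‖x - z‖ := by
    intro f x z
    calc ‖h f x - h f z‖ ≤ ∫ s, C * ‖x - z‖ * ‖f s‖ ∂μ := by
          rw [hh, ← integral_sub (hint f x) (hint f z)]
          refine norm_integral_le_of_norm_le ((Lp.integrable_of_two f).norm.const_mul _)
            (ae_of_all _ fun s => ?_)
          rw [← sub_mul, norm_mul, ← Complex.ofReal_sub, Complex.norm_real]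
          exact mul_le_mul_of_nonneg_right (hL x z s) (norm_nonneg _)
      _ ≤ C * ‖x - z‖ * (M * ‖f‖) := by
          rw [integral_const_mul]
          exact mul_le_mul_of_nonneg_left (hM f) (by positivity)
      _ = _ := by ring
  have hadd : ∀ f g x, h (f + g) x = h f x + h g x := by
    intro f g x
    rw [hh, ← integral_add (hint f x) (hint g x)]
    refine integral_congr_ae ?_
    filter_upwards [Lp.coeFn_add f g] with s hs
    rw [hs, Pi.add_apply, mul_add]
  have hsmul : ∀ (c : ℂ) f x, h (c • f) x = c * h f x := by
    intro c f x
    rw [hh, ← integral_const_mul]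
    refine integral_congr_ae ?_
    filter_upwards [Lp.coeFn_smul c f] with s hs
    rw [hs, Pi.smul_apply, smul_eq_mul, mul_left_comm]
  have hK : ∀ f : Lp ℂ 2 μ, 0 ≤ C * M * ‖f‖ := fun f => by positivity
  have hcont : ∀ f, Continuous (h f) := fun f => continuous_of_norm_sub_le (hK f) (hD f)
  have m1 : ∀ f, MemLp (h f) 2 σ := fun f => memLp_of_continuous_of_bound (hcont f) (hB f)
  have m2 := fun f => memLp_diffQuotient (σ := σ) (hcont f) (hK f) (hD f)
  let S₀ : Lp ℂ 2 μ → sobolevHalf σ := fun f =>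
    ⟨WithLp.toLp 2 ((m1 f).toLp, (m2 f).toLp), by
      change ∀ᵐ q ∂(σ.prod σ), (m2 f).toLp _ q
        = ((m1 f).toLp _ q.1 - (m1 f).toLp _ q.2) / (‖q.1 - q.2‖ : ℂ)
      filter_upwards [(m2 f).coeFn_toLp,
        Measure.quasiMeasurePreserving_fst.ae (m1 f).coeFn_toLp,
        Measure.quasiMeasurePreserving_snd.ae (m1 f).coeFn_toLp] with q e1 e2 e3
      rw [e1, e2, e3]⟩
  have hS₀ : ∀ f, (S₀ f).1.fst =ᵐ[σ] h f := fun f => (m1 f).coeFn_toLp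
  let S₁ : Lp ℂ 2 μ →ₗ[ℂ] sobolevHalf σ :=
    { toFun := S₀
      map_add' := fun f g => sobolevHalf_ext <| Lp.ext <| by
        change _ =ᵐ[σ] ⇑((S₀ f).1.fst + (S₀ g).1.fst)
        filter_upwards [hS₀ (f + g), hS₀ f, hS₀ g, Lp.coeFn_add (S₀ f).1.fst (S₀ g).1.fst]
          with x e1 e2 e3 e4
        rw [e1, e4, Pi.add_apply, e2, e3, hadd]
      map_smul' := fun c f => sobolevHalf_ext <| Lp.ext <| by
        change _ =ᵐ[σ] ⇑(c • (S₀ f).1.fst)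
        filter_upwards [hS₀ (c • f), hS₀ f, Lp.coeFn_smul c (S₀ f).1.fst] with x e1 e2 e3
        rw [e1, e3, Pi.smul_apply, e2, hsmul, smul_eq_mul] }
  refine ⟨S₁.mkContinuousOfExistsBound ⟨(σ.real Set.univ ^ (1 / 2 : ℝ)
    + (σ.prod σ).real Set.univ ^ (1 / 2 : ℝ)) * (C * M), fun f => ?_⟩, hS₀⟩
  have b1 : ‖(m1 f).toLp‖ ≤ σ.real Set.univ ^ (1 / 2 : ℝ) * (C * M * ‖f‖) := by
    refine (Lp.norm_le_of_ae_bound (hK f) ?_).trans_eq (by norm_num; exact Or.inl rfl)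
    filter_upwards [(m1 f).coeFn_toLp] with x hx
    rw [hx]
    exact hB f x
  have b2 : ‖(m2 f).toLp‖ ≤ (σ.prod σ).real Set.univ ^ (1 / 2 : ℝ) * (C * M * ‖f‖) := by
    refine (Lp.norm_le_of_ae_bound (hK f) ?_).trans_eq (by norm_num; exact Or.inl rfl)
    filter_upwards [(m2 f).coeFn_toLp] with x hx
    rw [hx]
    exact norm_diffQuotient_le (hK f) (hD f) x
  have b3 : ‖S₁ f‖ ≤ ‖(m1 f).toLp‖ + ‖(m2 f).toLp‖ := by
    change ‖(WithLp.toLp 2 ((m1 f).toLp, (m2 f).toLp) :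
      WithLp 2 (Lp ℂ 2 σ × Lp ℂ 2 (σ.prod σ)))‖ ≤ _
    rw [WithLp.prod_norm_eq_of_L2]
    exact Real.sqrt_le_iff.2 ⟨by positivity, by
      change ‖(m1 f).toLp‖ ^ 2 + ‖(m2 f).toLp‖ ^ 2 ≤ _
      nlinarith [norm_nonneg (m1 f).toLp, norm_nonneg (m2 f).toLp]⟩
  calc ‖S₁ f‖ ≤ _ := b3.trans (add_le_add b1 b2)
    _ = _ := by ring

/-- Composition with a map under which the pullback measure is dominated. -/
theorem exists_compLp {X Y : Type*} [MeasurableSpace X] [MeasurableSpace Y] {μ ν : Measure X}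
    {ρ : Measure Y} {g : X → Y} (hmp : MeasurePreserving g ν ρ) {c : ENNReal} (hc : c ≠ ⊤) (hμν : μ ≤ c • ν) :
    ∃ J : Lp ℂ 2 ρ →L[ℂ] Lp ℂ 2 μ, ∀ f, J f =ᵐ[μ] f ∘ g := by
  have hac : μ ≪ ν := (Measure.absolutelyContinuous_of_le hμν).trans
    (Measure.smul_absolutelyContinuous)
  have hq : Measure.QuasiMeasurePreserving g μ ρ := hmp.quasiMeasurePreserving.mono_left hac
  have m1 : ∀ f : Lp ℂ 2 ρ, MemLp (f ∘ g) 2 μ := fun f =>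
    ((Lp.memLp f).comp_measurePreserving hmp).of_measure_le_smul hc hμν
  let J₁ : Lp ℂ 2 ρ →ₗ[ℂ] Lp ℂ 2 μ :=
    { toFun := fun f => (m1 f).toLp
      map_add' := fun f h => by
        refine Lp.ext ?_
        filter_upwards [(m1 (f + h)).coeFn_toLp, Lp.coeFn_add (m1 f).toLp (m1 h).toLp,
          (m1 f).coeFn_toLp, (m1 h).coeFn_toLp, hq.ae (Lp.coeFn_add f h)] with x e1 e2 e3 e4 e5
        rw [e1, e2, Pi.add_apply, e3, e4]
        exact e5
      map_smul' := fun z f => by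
        refine Lp.ext ?_
        filter_upwards [(m1 (z • f)).coeFn_toLp, Lp.coeFn_smul z (m1 f).toLp,
          (m1 f).coeFn_toLp, hq.ae (Lp.coeFn_smul z f)] with x e1 e2 e3 e5
        rw [e1, RingHom.id_apply, e2, Pi.smul_apply, e3]
        exact e5 }
  refine ⟨J₁.mkContinuousOfExistsBound ⟨(c ^ (1 / 2 : ℝ)).toReal, fun f => ?_⟩,
    fun f => (m1 f).coeFn_toLp⟩
  change ‖(m1 f).toLp‖ ≤ _
  rw [Lp.norm_toLp, Lp.norm_def, ← ENNReal.toReal_mul,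
    ← eLpNorm_comp_measurePreserving (Lp.aestronglyMeasurable f) hmp]
  refine ENNReal.toReal_mono ?_ ((eLpNorm_le_of_measure_le_smul hμν).trans_eq (by norm_num))
  exact ENNReal.mul_ne_top (ENNReal.rpow_ne_top_of_nonneg (by norm_num) hc)
    ((Lp.memLp f).comp_measurePreserving hmp).eLpNorm_ne_top

/-! ### Geometry of the ellipse and cancellation of the singularity. -/

section Curve

variable {a b : ℝ}

theorem continuous_ellipseCurve (a b : ℝ) : Continuous (ellipseCurve a b) := by
  unfold ellipseCurve
  fun_prop

theorem deriv_ellipseCurve (a b t : ℝ) :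
    deriv (ellipseCurve a b) t = !₂[-(a * Real.sin t), b * Real.cos t] := by
  refine HasDerivAt.deriv ?_
  have h : HasDerivAt (fun t i => (![a * Real.cos t, b * Real.sin t] : Fin 2 → ℝ) i)
      ![-(a * Real.sin t), b * Real.cos t] t := by
    rw [hasDerivAt_pi]
    intro i
    fin_cases i
    · simpa using (Real.hasDerivAt_cos t).const_mul a
    · simpa using (Real.hasDerivAt_sin t).const_mul b
  exact (EuclideanSpace.equiv (Fin 2) ℝ).symm.hasFDerivAt.comp_hasDerivAt t h

theorem norm_deriv_ellipseCurve (a b t : ℝ) : ‖deriv (ellipseCurve a b) t‖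
    = √(a ^ 2 * Real.sin t ^ 2 + b ^ 2 * Real.cos t ^ 2) := by
  rw [deriv_ellipseCurve, EuclideanSpace.norm_eq]
  simp [Fin.sum_univ_two, mul_pow]

theorem measurable_norm_deriv_ellipseCurve (a b : ℝ) :
    Measurable fun t => ENNReal.ofReal ‖deriv (ellipseCurve a b) t‖ := by
  simp_rw [norm_deriv_ellipseCurve]
  fun_prop

theorem le_norm_deriv_ellipseCurve (hb : 0 < b) (hab : b < a) (t : ℝ) :
    b ≤ ‖deriv (ellipseCurve a b) t‖ := by
  rw [norm_deriv_ellipseCurve]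
  refine Real.le_sqrt_of_sq_le ?_
  nlinarith [Real.sin_sq_add_cos_sq t,
    mul_nonneg (show 0 ≤ a ^ 2 - b ^ 2 by nlinarith) (sq_nonneg (Real.sin t))]

theorem norm_deriv_ellipseCurve_le (hb : 0 < b) (hab : b < a) (t : ℝ) :
    ‖deriv (ellipseCurve a b) t‖ ≤ a := by
  rw [norm_deriv_ellipseCurve]
  refine Real.sqrt_le_iff.2 ⟨by linarith, ?_⟩
  nlinarith [Real.sin_sq_add_cos_sq t,
    mul_nonneg (show 0 ≤ a ^ 2 - b ^ 2 by nlinarith) (sq_nonneg (Real.cos t))]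

theorem isFiniteMeasure_lineElement (hb : 0 < b) (hab : b < a) :
    IsFiniteMeasure (lineElement a b) := by
  have : IsFiniteMeasure ((volume.restrict (Set.Ioc 0 (2 * Real.pi))).withDensity
      fun t => ENNReal.ofReal ‖deriv (ellipseCurve a b) t‖) := by
    refine isFiniteMeasure_withDensity (ne_of_lt ?_)
    calc _ ≤ ∫⁻ t in Set.Ioc 0 (2 * Real.pi), ENNReal.ofReal a :=
          lintegral_mono fun t => ENNReal.ofReal_le_ofReal (norm_deriv_ellipseCurve_le hb hab t)
      _ < ⊤ := by
          rw [lintegral_const]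
          exact ENNReal.mul_lt_top ENNReal.ofReal_lt_top (measure_lt_top _ _)
  unfold lineElement
  infer_instance

/-- The speed is at least b, so dt ≤ b⁻¹ ds. This makes the pullback to L²(dt) bounded and carries
ds-null sets to dt-null sets. -/
theorem restrict_le_smul_withDensity (hb : 0 < b) (hab : b < a) :
    volume.restrict (Set.Ioc 0 (2 * Real.pi)) ≤ ENNReal.ofReal b⁻¹ •
      (volume.restrict (Set.Ioc 0 (2 * Real.pi))).withDensity
        fun t => ENNReal.ofReal ‖deriv (ellipseCurve a b) t‖ := by
  rw [← withDensity_smul _ (measurable_norm_deriv_ellipseCurve a b)]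
  nth_rewrite 1 [← withDensity_one (μ := volume.restrict (Set.Ioc 0 (2 * Real.pi)))]
  refine withDensity_mono (ae_of_all _ fun t => ?_)
  rw [Pi.smul_apply, smul_eq_mul, ← ENNReal.ofReal_mul (by positivity), Pi.one_apply,
    ENNReal.one_le_ofReal, inv_mul_eq_div, one_le_div hb]
  exact le_norm_deriv_ellipseCurve hb hab t

/-- `ds`-almost every point of the plane lies on the curve. -/
theorem ae_range_ellipseCurve (a b : ℝ) :
    ∀ᵐ x ∂lineElement a b, ∃ t, ellipseCurve a b t = x := by
  unfold lineElement
  refine mem_of_superset (?_ : ellipseCurve a b '' Set.Icc 0 (2 * Real.pi) ∈ _)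
    (by rintro x ⟨t, -, rfl⟩; exact ⟨t, rfl⟩)
  have hm : MeasurableSet (ellipseCurve a b '' Set.Icc 0 (2 * Real.pi)) :=
    (isCompact_Icc.image (continuous_ellipseCurve a b)).measurableSet
  refine (ae_map_iff (continuous_ellipseCurve a b).aemeasurable hm).2 ?_
  refine (withDensity_absolutelyContinuous _ _).ae_le ?_
  filter_upwards [ae_restrict_mem measurableSet_Ioc] with t ht
  exact ⟨t, Set.Ioc_subset_Icc_self ht, rfl⟩

theorem integral_lineElement {F : Plane → ℂ}
    (hF : AEStronglyMeasurable F (lineElement a b)) : ∫ y, F y ∂lineElement a b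
    = ∫ s in Set.Ioc 0 (2 * Real.pi), (‖deriv (ellipseCurve a b) s‖ : ℂ) * F (ellipseCurve a b s) := by
  unfold lineElement at hF ⊢
  rw [integral_map (continuous_ellipseCurve a b).aemeasurable hF,
    integral_withDensity_eq_integral_toReal_smul (measurable_norm_deriv_ellipseCurve a b)
      (ae_of_all _ fun _ => ENNReal.ofReal_lt_top)]
  refine integral_congr_ae (ae_of_all _ fun s => ?_)
  simp only
  rw [ENNReal.toReal_ofReal (norm_nonneg _), Complex.real_smul]

theorem norm_ellipseCurve_sub_sq (a b t s : ℝ) :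
    ‖ellipseCurve a b t - ellipseCurve a b s‖ ^ 2
      = a ^ 2 * (Real.cos t - Real.cos s) ^ 2 + b ^ 2 * (Real.sin t - Real.sin s) ^ 2 := by
  rw [EuclideanSpace.norm_sq_eq, Fin.sum_univ_two]
  simp [ellipseCurve]
  ring

/-- The normal is the tangent turned by a right angle, so the speed cancels the normalization and ν
ds is polynomial in cos s and sin s. -/
theorem outwardNormal_ellipseCurve (hb : 0 < b) (hab : b < a) (s : ℝ) :
    ‖deriv (ellipseCurve a b) s‖ • outwardNormal a b (ellipseCurve a b s)
      = !₂[b * Real.cos s, a * Real.sin s] := by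
  have ha := hb.trans hab
  have h1 : (!₂[(ellipseCurve a b s) 0 / a ^ 2, (ellipseCurve a b s) 1 / b ^ 2] : Plane)
      = (a * b)⁻¹ • !₂[b * Real.cos s, a * Real.sin s] := by
    ext i
    fin_cases i
    · simp [ellipseCurve]; field_simp
    · simp [ellipseCurve]; field_simp
  have h2 : ‖(!₂[b * Real.cos s, a * Real.sin s] : Plane)‖ = ‖deriv (ellipseCurve a b) s‖ := by
    rw [norm_deriv_ellipseCurve, EuclideanSpace.norm_eq]
    simp [Fin.sum_univ_two, mul_pow, add_comm]
  have h3 := hb.trans_le (le_norm_deriv_ellipseCurve hb hab s)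
  rw [outwardNormal, h1, norm_smul, h2, smul_smul, smul_smul, Real.norm_of_nonneg (by positivity)]
  rw [show ‖deriv (ellipseCurve a b) s‖ * ((a * b)⁻¹ * ‖deriv (ellipseCurve a b) s‖)⁻¹ * (a * b)⁻¹
    = 1 by field_simp, one_smul]

/-- The numerator is ab(1 - cos(s - t)), and |x - y|² is the same factor 1 - cos(s - t) times a² +
b² - (a² - b²) cos(s + t). The hypothesis excludes only the diagonal, a null set in s. -/
theorem norm_deriv_mul_npKernel (hb : 0 < b) (hab : b < a) {t s : ℝ} (h : Real.cos (s - t) ≠ 1) :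
    ‖deriv (ellipseCurve a b) s‖ * npKernel a b (ellipseCurve a b t) (ellipseCurve a b s)
      = npProfile a b (Real.cos (s + t)) := by
  have ha := hb.trans hab
  have hD := (by positivity : 0 < 2 * b ^ 2).trans_le
    (two_mul_sq_le_npProfile_denom hb hab (Real.cos_le_one (s + t)))
  have h1 : ‖deriv (ellipseCurve a b) s‖ * inner ℝ (ellipseCurve a b s - ellipseCurve a b t)
      (outwardNormal a b (ellipseCurve a b s)) = a * b * (1 - Real.cos (s - t)) := by
    rw [← real_inner_smul_right, outwardNormal_ellipseCurve hb hab, PiLp.inner_apply,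
      Fin.sum_univ_two, Real.cos_sub]
    simp [ellipseCurve]
    linear_combination a * b * Real.sin_sq_add_cos_sq s
  have h2 : ‖ellipseCurve a b t - ellipseCurve a b s‖ ^ 2
      = (1 - Real.cos (s - t)) * ((a ^ 2 + b ^ 2) - (a ^ 2 - b ^ 2) * Real.cos (s + t)) := by
    rw [norm_ellipseCurve_sub_sq, Real.cos_sub, Real.cos_add]
    have e1 := Real.sin_sq_add_cos_sq s
    have e2 := Real.sin_sq_add_cos_sq t
    have e3 : Real.sin s ^ 2 = 1 - Real.cos s ^ 2 := by linarith
    have e4 : Real.sin t ^ 2 = 1 - Real.cos t ^ 2 := by linarith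
    ring_nf
    simp only [e3, e4]
    ring
  have h3 : 1 - Real.cos (s - t) ≠ 0 := sub_ne_zero.2 h.symm
  rw [npKernel, npProfile_cos, mul_left_comm, ← mul_div_assoc, h1, h2]
  have := Real.pi_pos
  field_simp

theorem ae_cos_sub_ne_one (t : ℝ) : ∀ᵐ s : ℝ, Real.cos (s - t) ≠ 1 := by
  have : {s : ℝ | Real.cos (s - t) = 1} ⊆ Set.range fun n : ℤ => n * (2 * Real.pi) + t := by
    intro s hs
    obtain ⟨n, hn⟩ := (Real.cos_eq_one_iff _).1 hs
    exact ⟨n, by simp only; linarith⟩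
  have h0 : volume {s : ℝ | Real.cos (s - t) = 1} = 0 :=
    measure_mono_null this ((Set.countable_range _).measure_zero volume)
  exact measure_eq_zero_iff_ae_notMem.1 h0

end Curve

/-! ### The Neumann–Poincaré operator on H^{1/2} and its spectrum. -/

theorem measurable_npKernel (a b : ℝ) (x : Plane) : Measurable (npKernel a b x) := by
  unfold npKernel outwardNormal
  have h1 : Continuous fun y : Plane => (!₂[y 0 / a ^ 2, y 1 / b ^ 2] : Plane) := by fun_prop
  have h2 := h1.norm.measurable.inv
  have h3 : Measurable fun y : Plane => y - x := measurable_id.sub_const x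
  have h4 : Measurable fun y : Plane => ‖x - y‖ ^ 2 := by fun_prop
  exact ((h3.inner (h2.smul h1.measurable)).div h4).const_mul _

section
variable {a b : ℝ}

theorem quasiMeasurePreserving_ellipseCurve (hb : 0 < b) (hab : b < a) :
    Measure.QuasiMeasurePreserving (ellipseCurve a b)
      (volume.restrict (Set.Ioc 0 (2 * Real.pi))) (lineElement a b) :=
  ⟨(continuous_ellipseCurve a b).measurable,
    ((Measure.absolutelyContinuous_of_le (restrict_le_smul_withDensity hb hab)).trans
      Measure.smul_absolutelyContinuous).map (continuous_ellipseCurve a b).measurable⟩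

/-- The smooth form of the Neumann–Poincaré kernel, in terms of a point of the plane and the
parameter of a boundary point. -/
noncomputable def npSmoothKernel (a b : ℝ) (x : Plane) (s : ℝ) : ℝ :=
  npProfile a b (x 0 / a * Real.cos s - x 1 / b * Real.sin s)

theorem npSmoothKernel_ellipseCurve (hb : 0 < b) (hab : b < a) (t s : ℝ) :
    npSmoothKernel a b (ellipseCurve a b t) s = npProfile a b (Real.cos (s + t)) := by
  have ha := hb.trans hab
  rw [npSmoothKernel, Real.cos_add]
  simp only [ellipseCurve, PiLp.toLp_apply, Matrix.cons_val_zero, Matrix.cons_val_one]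
  congr 1
  field_simp

theorem continuous_npSmoothKernel (hb : 0 < b) (hab : b < a) (x : Plane) :
    Continuous (npSmoothKernel a b x) := by
  have := continuous_npProfile hb hab
  unfold npSmoothKernel
  fun_prop

/-- Off the ellipse the argument of the profile may leave [-1, 1]; the clamp in `npProfile` keeps
the bounds uniform over the plane, as `exists_integralOperator_sobolevHalf` requires. -/
theorem exists_bound_npSmoothKernel (hb : 0 < b) (hab : b < a) :
    ∃ C, 0 ≤ C ∧ (∀ x s, |npSmoothKernel a b x s| ≤ C) ∧
      ∀ x z s, |npSmoothKernel a b x s - npSmoothKernel a b z s| ≤ C * ‖x - z‖ := by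
  have ha := hb.trans hab
  obtain ⟨C, hC0, hC⟩ := exists_npProfile_lipschitz hb hab
  refine ⟨max (a * b / (2 * Real.pi * (2 * b ^ 2))) (C * (a⁻¹ + b⁻¹)),
    le_max_of_le_right (by positivity), fun x s => ?_, fun x z s => ?_⟩
  · rw [npSmoothKernel, abs_of_pos (npProfile_pos hb hab _)]
    exact (npProfile_le hb hab _).trans (le_max_left _ _)
  · refine le_trans ?_ (mul_le_mul_of_nonneg_right (le_max_right _ _) (norm_nonneg _))
    have hco : ∀ i, |x i - z i| ≤ ‖x - z‖ := fun i => by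
      simpa using PiLp.norm_apply_le (x - z) i
    refine (hC _ _).trans ?_
    rw [mul_assoc]
    refine mul_le_mul_of_nonneg_left ?_ hC0
    calc _ = |(x 0 - z 0) * (a⁻¹ * Real.cos s) - (x 1 - z 1) * (b⁻¹ * Real.sin s)| := by
          congr 1; ring
      _ ≤ |x 0 - z 0| * (a⁻¹ * |Real.cos s|) + |x 1 - z 1| * (b⁻¹ * |Real.sin s|) := by
          refine (abs_sub _ _).trans_eq ?_
          simp only [abs_mul, abs_of_pos (inv_pos.2 ha), abs_of_pos (inv_pos.2 hb)]
      _ ≤ ‖x - z‖ * (a⁻¹ * 1) + ‖x - z‖ * (b⁻¹ * 1) := by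
          gcongr
          · exact hco 0
          · exact Real.abs_cos_le_one s
          · exact hco 1
          · exact Real.abs_sin_le_one s
      _ = _ := by ring

theorem integrable_npKernel_mul (hb : 0 < b) (hab : b < a) (t : ℝ)
    (f : Lp ℂ 2 (lineElement a b)) {g : Lp ℂ 2 (volume.restrict (Set.Ioc 0 (2 * Real.pi)))}
    (hg : g =ᵐ[volume.restrict (Set.Ioc 0 (2 * Real.pi))] f ∘ ellipseCurve a b) :
    Integrable (fun y => (npKernel a b (ellipseCurve a b t) y : ℂ) * f y) (lineElement a b) ∧
    ∫ y, (npKernel a b (ellipseCurve a b t) y : ℂ) * f y ∂lineElement a b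
      = ∫ s in Set.Ioc 0 (2 * Real.pi),
        (npSmoothKernel a b (ellipseCurve a b t) s : ℂ) * g s := by
  have hm : AEStronglyMeasurable
      (fun y => (npKernel a b (ellipseCurve a b t) y : ℂ) * f y) (lineElement a b) :=
    (Complex.measurable_ofReal.comp (measurable_npKernel a b _)).aestronglyMeasurable.mul
      (Lp.aestronglyMeasurable f)
  have he : (fun s => (‖deriv (ellipseCurve a b) s‖ : ℂ) *
      ((npKernel a b (ellipseCurve a b t) (ellipseCurve a b s) : ℂ) * f (ellipseCurve a b s)))
      =ᵐ[volume.restrict (Set.Ioc 0 (2 * Real.pi))]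
      fun s => (npSmoothKernel a b (ellipseCurve a b t) s : ℂ) * g s := by
    filter_upwards [ae_restrict_of_ae (ae_cos_sub_ne_one t), hg] with s hs e
    rw [npSmoothKernel_ellipseCurve hb hab, ← norm_deriv_mul_npKernel hb hab hs, e,
      Function.comp_apply]
    push_cast
    ring
  refine ⟨?_, ?_⟩
  · obtain ⟨C, -, hC, -⟩ := exists_bound_npSmoothKernel hb hab
    have hi : Integrable (fun s => (npSmoothKernel a b (ellipseCurve a b t) s : ℂ) * g s)
        (volume.restrict (Set.Ioc 0 (2 * Real.pi))) :=
      (Lp.integrable_of_two g).bdd_mul (c := C)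
        (Complex.continuous_ofReal.comp
          (continuous_npSmoothKernel hb hab _)).aestronglyMeasurable
        (ae_of_all _ fun s => by simpa using hC _ s)
    unfold lineElement at hm ⊢
    rw [integrable_map_measure hm (continuous_ellipseCurve a b).aemeasurable,
      integrable_withDensity_iff_integrable_smul' (measurable_norm_deriv_ellipseCurve a b)
        (ae_of_all _ fun _ => ENNReal.ofReal_lt_top)]
    refine hi.congr (he.symm.trans (ae_of_all _ fun s => ?_))
    simp only
    rw [ENNReal.toReal_ofReal (norm_nonneg _), Complex.real_smul]
    rfl
  · rw [integral_lineElement hm]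
    exact integral_congr_ae he

/-- For an integrable integrand, dominated convergence identifies the principal value with the plain
integral. -/
theorem tendsto_setIntegral_npKernel {σ : Measure Plane} {x : Plane} {f : Plane → ℂ}
    (hf : Integrable (fun y => (npKernel a b x y : ℂ) * f y) σ) :
    Tendsto (fun ε : ℝ => ∫ y in {y : Plane | ε < ‖x - y‖}, (npKernel a b x y : ℂ) * f y ∂σ)
      (𝓝[>] 0) (𝓝 (∫ y, (npKernel a b x y : ℂ) * f y ∂σ)) := by
  have hm : ∀ ε : ℝ, MeasurableSet {y : Plane | ε < ‖x - y‖} := fun ε =>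
    (isOpen_lt continuous_const (by fun_prop)).measurableSet
  simp_rw [← integral_indicator (hm _)]
  refine tendsto_integral_filter_of_dominated_convergence
    (fun y => ‖(npKernel a b x y : ℂ) * f y‖) ?_ ?_ hf.norm ?_
  · exact Eventually.of_forall fun ε => hf.aestronglyMeasurable.indicator (hm ε)
  · exact Eventually.of_forall fun ε => ae_of_all _ fun y => norm_indicator_le_norm_self _ _
  · refine ae_of_all _ fun y => ?_
    by_cases hxy : x = y
    · subst hxy
      -- The truncation always removes y = x, which could be an atom of a general σ; there the
      -- kernel is 0/0 = 0, so nothing is lost.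
      have : npKernel a b x x = 0 := by simp [npKernel]
      refine tendsto_const_nhds.congr' (Eventually.of_forall fun ε => ?_)
      simp [Set.indicator_apply, this]
    · refine tendsto_const_nhds.congr' ?_
      have : 0 < ‖x - y‖ := norm_pos_iff.2 (sub_ne_zero.2 hxy)
      filter_upwards [mem_nhdsWithin_of_mem_nhds (Iio_mem_nhds this)] with ε hε
      rw [Set.indicator_of_mem (show y ∈ {y : Plane | ε < ‖x - y‖} from hε)]

theorem IsNPOperator.unique {T K : HHalf a b →L[ℂ] HHalf a b} (hT : IsNPOperator T)
    (hK : IsNPOperator K) : T = K := by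
  ext1 φ
  refine sobolevHalf_ext (Lp.ext ?_)
  filter_upwards [hT φ, hK φ] with x h1 h2
  exact tendsto_nhds_unique h1 h2

/-- The Neumann–Poincaré operator factors through `L²` of the parameter interval. -/
theorem exists_npOperator_factorization (hb : 0 < b) (hab : b < a) :
    ∃ (S : Lp ℂ 2 (volume.restrict (Set.Ioc 0 (2 * Real.pi))) →L[ℂ] HHalf a b)
      (J : HHalf a b →L[ℂ] Lp ℂ 2 (volume.restrict (Set.Ioc 0 (2 * Real.pi)))),
      IsNPOperator (S ∘L J) ∧ ∀ f, (J ∘L S) f =ᵐ[volume.restrict (Set.Ioc 0 (2 * Real.pi))]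
        fun t => ∫ s in Set.Ioc 0 (2 * Real.pi), (npProfile a b (Real.cos (s + t)) : ℂ) * f s := by
  have := isFiniteMeasure_lineElement hb hab
  obtain ⟨C, hC0, hC, hL⟩ := exists_bound_npSmoothKernel hb hab
  obtain ⟨S, hS⟩ := exists_integralOperator_sobolevHalf (σ := lineElement a b)
    (μ := volume.restrict (Set.Ioc 0 (2 * Real.pi))) hC0
    (fun x => (continuous_npSmoothKernel hb hab x).measurable) hC hL
  obtain ⟨J, hJ⟩ := exists_compLp (ρ := lineElement a b)
    ⟨(continuous_ellipseCurve a b).measurable, rfl⟩ ENNReal.ofReal_ne_top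
    (restrict_le_smul_withDensity hb hab)
  refine ⟨S, J ∘L (WithLp.fstL 2 ℂ _ _) ∘L (sobolevHalf (lineElement a b)).subtypeL,
    fun φ => ?_, fun f => ?_⟩
  · filter_upwards [ae_range_ellipseCurve a b, hS (J φ.toLp)] with x hx e
    obtain ⟨t, rfl⟩ := hx
    obtain ⟨h1, h2⟩ := integrable_npKernel_mul hb hab t φ.toLp (hJ φ.toLp)
    have h3 := tendsto_setIntegral_npKernel h1
    rw [h2, ← e] at h3
    exact h3
  · have e := (quasiMeasurePreserving_ellipseCurve hb hab).ae (hS f)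
    filter_upwards [hJ (S f).1.fst, e] with t e1 e2
    refine e1.trans ?_
    rw [Function.comp_apply, e2]
    simp_rw [npSmoothKernel_ellipseCurve hb hab]

theorem exists_npOperator (hb : 0 < b) (hab : b < a) :
    ∃ K : HHalf a b →L[ℂ] HHalf a b, (∀ T, IsNPOperator T ↔ T = K) ∧
      spectrum ℂ K ⊆ (fun t : ℝ => (t : ℂ)) '' Set.Icc (-(1 / 2) : ℝ) (1 / 2) ∧
      ∀ n : ℕ, (((((a - b) / (a + b)) ^ (n + 1) / 2 : ℝ) : ℂ) ∈ spectrum ℂ K ∧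
        ((-(((a - b) / (a + b)) ^ (n + 1) / 2) : ℝ) : ℂ) ∈ spectrum ℂ K) := by
  obtain ⟨S, J, hK, hJS⟩ := exists_npOperator_factorization hb hab
  have hpi := Real.pi_pos
  have hcp := continuous_npProfile hb hab
  have hr : 0 < (a - b) / (a + b) := div_pos (by linarith) (by linarith)
  refine ⟨S ∘L J, fun T => ⟨fun hT => hT.unique hK, fun h => h ▸ hK⟩, fun z hz => ?_, ?_⟩
  -- Exchanging the factors says nothing about 0, but 0 lies in the interval anyway.
  · by_cases h0 : z = 0
    · exact ⟨0, by norm_num, by simp [h0]⟩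
    have hz' := mem_spectrum_comp_of_mem_spectrum_comp S J h0 hz
    have hm : Measurable (Function.uncurry fun t s => npProfile a b (Real.cos (s + t))) :=
      (by fun_prop : Continuous fun q : ℝ × ℝ => npProfile a b (Real.cos (q.2 + q.1))).measurable
    have hC : ∀ t s, |npProfile a b (Real.cos (s + t))| ≤ a * b / (2 * Real.pi * (2 * b ^ 2)) :=
      fun t s => by rw [abs_of_pos (npProfile_pos hb hab _)]; exact npProfile_le hb hab _
    have hsymm : ∀ s t, npProfile a b (Real.cos (t + s)) = npProfile a b (Real.cos (s + t)) :=
      fun s t => by rw [add_comm]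
    have hsa := isSelfAdjoint_integralOperator hm hC hsymm hJS
    -- The Schur constant 1/2 is the case n = 0, θ = 0 of the cosine formula, that is, the integral
    -- of the profile.
    have hnorm := norm_integralOperator_le hm hC hsymm (fun s t => (npProfile_pos hb hab _).le)
      one_half_pos (fun t => by simpa using integral_npProfile_mul_cos hb hab 0 0 t) hJS
    have hre := hsa.mem_spectrum_eq_re hz'
    have hle := (spectrum.norm_le_norm_mul_of_mem hz').trans
      (mul_le_of_le_one_right (norm_nonneg _) ContinuousLinearMap.norm_id_le) |>.trans hnorm
    refine ⟨z.re, ?_, hre.symm⟩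
    exact abs_le.1 ((Complex.abs_re_le_norm z).trans hle)
  -- The eigenfunction is cos(ns - θ): θ = 0, e = 1 gives cosines and θ = π/2, e = -1 gives sines.
  -- At s₀ it equals 1, so by continuity it is not almost everywhere zero.
  · have eig : ∀ (n : ℕ) (θ e s₀ : ℝ), e ≠ 0 → s₀ ∈ Set.Ioc 0 (2 * Real.pi) →
        Real.cos (n * s₀ - θ) = 1 → (∀ t, Real.cos (n * t + θ) = e * Real.cos (n * t - θ)) →
        ((((a - b) / (a + b)) ^ n / 2 * e : ℝ) : ℂ) ∈ spectrum ℂ (S ∘L J) := by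
      intro n θ e s₀ he hs₀ hs₁ hθ
      refine mem_spectrum_comp_of_mem_spectrum_comp J S ?_ ?_
      · exact_mod_cast mul_ne_zero (by positivity) he
      have hcont : Continuous fun s : ℝ => (Real.cos (n * s - θ) : ℂ) := by fun_prop
      have hmem : MemLp (fun s : ℝ => (Real.cos (n * s - θ) : ℂ)) 2
          (volume.restrict (Set.Ioc 0 (2 * Real.pi))) :=
        MemLp.of_bound hcont.aestronglyMeasurable 1 (ae_of_all _ fun s => by
          rw [Complex.norm_real]
          exact Real.abs_cos_le_one (n * s - θ))
      refine mem_spectrum_of_apply_eq_smul (v := hmem.toLp) ?_ ?_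
      · intro h0
        have h1 := hmem.coeFn_toLp
        rw [h0] at h1
        have h2 := Measure.eqOn_Ioc_of_ae_eq volume
          (h1.symm.trans (Lp.coeFn_zero ℂ 2 _)) hcont.continuousOn continuousOn_const hs₀
        simp only [hs₁] at h2
        norm_num at h2
      · refine Lp.ext ?_
        filter_upwards [hJS hmem.toLp, hmem.coeFn_toLp, Lp.coeFn_smul
          ((((a - b) / (a + b)) ^ n / 2 * e : ℝ) : ℂ) hmem.toLp] with t e1 e2 e3
        rw [e1, e3, Pi.smul_apply, e2, smul_eq_mul, ← Complex.ofReal_mul, mul_assoc, ← hθ,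
          ← integral_npProfile_mul_cos hb hab, ← integral_complex_ofReal]
        refine integral_congr_ae ?_
        filter_upwards [hmem.coeFn_toLp] with s hs
        rw [hs, Complex.ofReal_mul]
    -- The exponent starts at 1 because sin(ns) vanishes identically for n = 0, so -1/2 is not
    -- obtained as an eigenvalue this way.
    intro n
    refine ⟨?_, ?_⟩
    · have := eig (n + 1) 0 1 (2 * Real.pi) one_ne_zero ⟨by positivity, le_rfl⟩
        (by rw [sub_zero, Real.cos_nat_mul_two_pi]) (by simp)
      simpa only [mul_one] using this
    · have := eig (n + 1) (Real.pi / 2) (-1) (Real.pi / 2 / (n + 1)) (by norm_num)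
        ⟨by positivity, ?_⟩ ?_ ?_
      · simpa only [mul_neg, mul_one] using this
      · rw [div_le_iff₀ (by positivity)]
        nlinarith [mul_nonneg hpi.le n.cast_nonneg (α := ℝ)]
      · push_cast
        rw [mul_div_cancel₀ _ (by positivity), sub_self, Real.cos_zero]
      · intro t
        rw [Real.cos_add_pi_div_two, Real.cos_sub_pi_div_two, neg_one_mul]

end

/-! ### Density of the eigenvalues and conclusion. -/

/-- Powers of numbers tending to `1` from below are dense in `[0, 1]`. -/
theorem exists_abs_pow_sub_lt {r : ℕ → ℝ} (h0 : ∀ j, 0 < r j) (h1 : ∀ j, r j < 1)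
    (hr : Tendsto r atTop (𝓝 1)) {x ε : ℝ} (hx0 : 0 ≤ x) (hx1 : x ≤ 1) (hε : 0 < ε) :
    ∃ j n, |r j ^ (n + 1) - x| < ε := by
  rcases hx0.eq_or_lt with rfl | hx
  · obtain ⟨n, hn⟩ := exists_pow_lt_of_lt_one hε (h1 0)
    refine ⟨0, n, ?_⟩
    rw [sub_zero, abs_of_pos (pow_pos (h0 0) _), pow_succ]
    exact (mul_le_of_le_one_right (pow_pos (h0 0) n).le (h1 0).le).trans_lt hn
  obtain ⟨j, hj⟩ := (hr.eventually (lt_mem_nhds (show 1 - ε < 1 by linarith))).exists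
  -- Here r_j^(n+1) < x ≤ r_j^n, and the gap r_j^n (1 - r_j) is below ε.
  obtain ⟨n, hn1, hn2⟩ := exists_nat_pow_near_of_lt_one hx hx1 (h0 j) (h1 j)
  refine ⟨j, n, ?_⟩
  rw [abs_sub_comm, abs_of_pos (by linarith)]
  have h3 : r j ^ n ≤ 1 := pow_le_one₀ (h0 j).le (h1 j).le
  rw [pow_succ]
  nlinarith [h1 j]

theorem mainTheorem3 (a b : ℕ → ℝ) (hb : ∀ j, 0 < b j) (hab : ∀ j, b j < a j)
    (hlim : Tendsto (fun j => b j / a j) atTop (𝓝 0)) :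
    ∃ K : ∀ j, HHalf (a j) (b j) →L[ℂ] HHalf (a j) (b j),
      (∀ j, ∀ T : HHalf (a j) (b j) →L[ℂ] HHalf (a j) (b j), IsNPOperator T ↔ T = K j) ∧
      closure (⋃ j, spectrum ℂ (K j)) =
        (fun t : ℝ => (t : ℂ)) '' Set.Icc (-(1 / 2) : ℝ) (1 / 2) := by
  choose K hK hsub hmem using fun j => exists_npOperator (hb j) (hab j)
  refine ⟨K, hK, Set.Subset.antisymm ?_ ?_⟩
  · exact closure_minimal (Set.iUnion_subset hsub)
      (isCompact_Icc.image Complex.continuous_ofReal).isClosed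
  have ha : ∀ j, 0 < a j := fun j => (hb j).trans (hab j)
  have hr : Tendsto (fun j => (a j - b j) / (a j + b j)) atTop (𝓝 1) := by
    have h : Tendsto (fun j => (1 - b j / a j) / (1 + b j / a j)) atTop
        (𝓝 ((1 - 0) / (1 + 0))) :=
      (tendsto_const_nhds.sub hlim).div (tendsto_const_nhds.add hlim) (by norm_num)
    rw [sub_zero, add_zero, div_one] at h
    refine h.congr fun j => ?_
    have := ha j
    field_simp
  rintro _ ⟨x, hx, rfl⟩
  rw [Metric.mem_closure_iff]
  intro ε hε
  -- The target is 2|x| because the eigenvalues are ±r_j^(n+1)/2; the sign of x then selects the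
  -- cosine or the sine eigenvalue.
  obtain ⟨j, n, hjn⟩ := exists_abs_pow_sub_lt
    (fun j => div_pos (sub_pos.2 (hab j)) (add_pos (ha j) (hb j)))
    (fun j => by rw [div_lt_one (add_pos (ha j) (hb j))]; linarith [hb j]) hr
    (x := 2 * |x|) (by positivity) (by linarith [abs_le.2 hx]) hε
  set p := ((a j - b j) / (a j + b j)) ^ (n + 1)
  rw [abs_lt] at hjn
  rcases le_total 0 x with h | h
  · refine ⟨_, Set.mem_iUnion.2 ⟨j, (hmem j n).1⟩, ?_⟩
    rw [Complex.isometry_ofReal.dist_eq, Real.dist_eq, abs_lt]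
    rw [abs_of_nonneg h] at hjn
    constructor <;> linarith
  · refine ⟨_, Set.mem_iUnion.2 ⟨j, (hmem j n).2⟩, ?_⟩
    rw [Complex.isometry_ofReal.dist_eq, Real.dist_eq, abs_lt]
    rw [abs_of_nonpos h] at hjn
    constructor <;> linarith
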